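/- There exist absolute constants $C, c > 0$ such that the following holds. Let $n, k, d \in \mathbb{N}$ with $k \ge 2$ and $d \ge 3$, let $\delta \in (0, 1/4]$, and let $\sigma_1, \dots, \sigma_n \ge 1$ satisfy $$\sum_{i=1}^n \frac{1}{\sigma_i^{4k-2}} \ge (Ck)^{2k-1} \log(1/\delta) \quad\text{and}\quad \sum_{i=1}^n \frac{1}{\sigma_i^4} \ge C\,(d + \log(1/\delta)).$$ Then for every estimator $\widehat T$, i.e. every map from $(\mathbb{R}^d)^n$ to the Borel probability measures on $\mathbb{R}^d$, there exists a $k$-atomic distribution $\mathcal{D} = \sum_{j=1}^k w_j \delta_{\mu_j}$ (with $w_j \ge 0$, $\sum_j w_j = 1$) supported on the closed Euclidean unit ball of $\mathbb{R}^d$ such that, for $\mathbf{X} = (X_1, \dots, X_n) \sim \prod_{i=1}^n \mathcal{D} * \mathcal{N}(0, \sigma_i^2 I)$, $$\mathbb{P}_{\mathbf X}\left\{ W_1(\widehat T(\mathbf X), \mathcal D) \ge c \max\left\{ \left(\frac{d + \log(1/\delta)}{\sum_{i=1}^n 1/\sigma_i^4}\right)^{1/4},\ \frac1k \left(\frac{1}{\log(1/\delta)}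 \sum_{i=1}^n \frac{1}{\sigma_i^{4k-2}}\right)^{-1/(4k-2)} \right\} \right\} \ge \delta .$$ Here $W_1(\mu, \nu)$ is the Wasserstein-1 distance, the infimum of $\mathbb{E}\|X - X'\|$ over all couplings $(X, X')$ of $\mu$ and $\nu$ (possibly $+\infty$), with $\|\cdot\|$ the Euclidean norm. -/

import Mathlib

open MeasureTheory ProbabilityTheory
open scoped NNReal ENNReal

/-- `π` is a coupling of `μ` and `ν`: a measure on the product space with marginals `μ`, `ν`. -/
def IsCoupling {E : Type*} [MeasurableSpace E] (μ ν : Measure E) (π : Measure (E × E)) : Prop :=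
  π.map Prod.fst = μ ∧ π.map Prod.snd = ν

/-- The Wasserstein-1 distance: the infimum of `𝔼 ‖X - X'‖` over all couplings of `μ` and `ν`,
as an extended nonnegative number (it is `∞` when no coupling has finite cost). -/
noncomputable def wasserstein {E : Type*} [NormedAddCommGroup E] [MeasurableSpace E]
    (μ ν : Measure E) : ℝ≥0∞ :=
  ⨅ (π : Measure (E × E)) (_ : IsCoupling μ ν π), ∫⁻ p, ‖p.1 - p.2‖ₑ ∂π

/-- `D = ∑ i, w i • δ_{m i}` with `k` nonnegative weights summing to one. -/
def IsKAtomic {E : Type*} [MeasurableSpace E] (k : ℕ) (D : Measure E) : Prop :=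
  ∃ (w : Fin k → ℝ≥0) (m : Fin k → E), ∑ i, w i = 1 ∧ D = ∑ i, w i • Measure.dirac (m i)

/-- The isotropic Gaussian `N(0, σ² I)` on `ℝ^d`: the law of `σ Z` with `Z` standard Gaussian. -/
noncomputable def isotropicGaussian (d : ℕ) (σ : ℝ) : Measure (EuclideanSpace ℝ (Fin d)) :=
  (stdGaussian (EuclideanSpace ℝ (Fin d))).map (fun z => σ • z)

/-- The law `∏ i, D ∗ N(0, σ i ² I)` of the sample `(X_1, …, X_n)`. -/
noncomputable def sampleLaw {n d : ℕ} (σ : Fin n → ℝ) (D : Measure (EuclideanSpace ℝ (Fin d))) :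
    Measure (Fin n → EuclideanSpace ℝ (Fin d)) :=
  Measure.pi (fun i => D.conv (isotropicGaussian d (σ i)))

/-! An estimator that is accurate for two distributions with supports at distance `g` must tell
their samples apart, since no probability measure is within `W₁`-distance less than `g / 2` of both
(`le_wasserstein_add_wasserstein`). It therefore suffices to find separated distributions with
nearly indistinguishable samples.

Indistinguishability is measured by chi-square. Gaussian densities relative to `N(0, I)` have inner
product `exp ⟪u, v⟫`; expanding the exponential shows that two mixtures on a segment of length scale
`η`, with equal moments of order below `m`, have chi-square of order `(η / σ)^(2m)` at noise level
`σ`. Tensorizing gives `P(B)² ≤ Q(B) exp(20 η^(2m) ∑ σⱼ^(-2m))` (`sq_sampleLaw_le_of_moments_eq`).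

Three constructions suffice. The even and odd halves of a binomial law on `2k` points have `m = 2k -
1` and gap `1 / (2k - 1)`, which yields the `4k - 2` term. For the fourth-root term, `±η` against
`0` has `m = 2` and yields the `log (1/δ)` contribution. When `d` dominates, `±η` is placed along a
direction drawn from all `2^d` sign vectors: each such law is close to the point mass at `0`, while
one output can be near only an exponentially small fraction of them. -/

/-! ### Gaussian densities and their inner products. -/

/-- The density of `N(u, I)` with respect to `N(0, I)`. -/
noncomputable def gaussianTilt {d : ℕ} (u x : EuclideanSpace ℝ (Fin d)) : ℝ :=
  Real.exp (inner ℝ u x - ‖u‖ ^ 2 / 2)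

lemma gaussianTilt_pos {d : ℕ} (u x : EuclideanSpace ℝ (Fin d)) : 0 < gaussianTilt u x :=
  Real.exp_pos _

@[fun_prop]
lemma measurable_gaussianTilt {d : ℕ} (u : EuclideanSpace ℝ (Fin d)) :
    Measurable (gaussianTilt u) := by
  unfold gaussianTilt; fun_prop

/-- Complex `z` are allowed so that the same formula serves exponential moments and the
characteristic function of a tilted Gaussian. -/
lemma integral_cexp_stdGaussian {d : ℕ} (z : Fin d → ℂ) :
    ∫ x : EuclideanSpace ℝ (Fin d), Complex.exp (∑ i, z i * x i) ∂stdGaussian _ =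
      Complex.exp (∑ i, z i ^ 2 / 2) := by
  have h1 (w : ℂ) : ∫ x : ℝ, Complex.exp (w * x) ∂gaussianReal 0 1 = Complex.exp (w ^ 2 / 2) := by
    have := complexMGF_id_gaussianReal (μ := 0) (v := 1) w
    simpa [complexMGF] using this
  rw [← map_pi_eq_stdGaussian, integral_map (by fun_prop)
    (Measurable.aestronglyMeasurable (by fun_prop))]
  simp_rw [Complex.exp_sum]
  rw [integral_fintype_prod_eq_prod (f := fun i (x : ℝ) ↦ Complex.exp (z i * x))]
  simp_rw [h1]

lemma integrable_exp_inner_stdGaussian {d : ℕ} (u : EuclideanSpace ℝ (Fin d)) :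
    Integrable (fun x ↦ Real.exp (inner ℝ u x)) (stdGaussian (EuclideanSpace ℝ (Fin d))) := by
  rw [← map_pi_eq_stdGaussian, integrable_map_measure
    (Measurable.aestronglyMeasurable (by fun_prop)) (by fun_prop)]
  have : ((fun x : EuclideanSpace ℝ (Fin d) ↦ Real.exp (inner ℝ u x)) ∘ WithLp.toLp 2) =
      fun x : Fin d → ℝ ↦ ∏ i, Real.exp (u i * x i) := by
    ext x
    simp [PiLp.inner_apply, Real.exp_sum, mul_comm]
  rw [this]
  exact Integrable.fintype_prod (f := fun i (x : ℝ) ↦ Real.exp (u i * x))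
    fun i ↦ by simpa using integrable_exp_mul_gaussianReal (u i)

lemma integrable_gaussianTilt {d : ℕ} (u : EuclideanSpace ℝ (Fin d)) :
    Integrable (gaussianTilt u) (stdGaussian (EuclideanSpace ℝ (Fin d))) := by
  have : gaussianTilt u = fun x ↦ Real.exp (inner ℝ u x) * Real.exp (- (‖u‖ ^ 2 / 2)) := by
    ext x; rw [gaussianTilt, sub_eq_add_neg, Real.exp_add]
  rw [this]
  exact (integrable_exp_inner_stdGaussian u).mul_const _

lemma integral_gaussianTilt {d : ℕ} (u : EuclideanSpace ℝ (Fin d)) :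
    ∫ x, gaussianTilt u x ∂stdGaussian (EuclideanSpace ℝ (Fin d)) = 1 := by
  have h := integral_cexp_stdGaussian (fun i ↦ (u i : ℂ))
  have h2 : ∫ x, Real.exp (inner ℝ u x) ∂stdGaussian (EuclideanSpace ℝ (Fin d)) =
      Real.exp (‖u‖ ^ 2 / 2) := by
    have e1 (x : EuclideanSpace ℝ (Fin d)) :
        Complex.exp (∑ i, (u i : ℂ) * x i) = ((Real.exp (inner ℝ u x) : ℝ) : ℂ) := by
      simp [PiLp.inner_apply, mul_comm]
    simp_rw [e1] at h
    rw [integral_complex_ofReal, ← Finset.sum_div] at h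
    have e2 : Complex.exp ((∑ i, (u i : ℂ) ^ 2) / 2) = ((Real.exp (‖u‖ ^ 2 / 2) : ℝ) : ℂ) := by
      rw [EuclideanSpace.real_norm_sq_eq]; push_cast; rfl
    rw [e2] at h
    exact_mod_cast h
  simp_rw [gaussianTilt, Real.exp_sub, integral_div, h2]
  exact div_self (Real.exp_pos _).ne'

lemma gaussianTilt_mul {d : ℕ} (u v x : EuclideanSpace ℝ (Fin d)) :
    gaussianTilt u x * gaussianTilt v x = Real.exp (inner ℝ u v) * gaussianTilt (u + v) x := by
  simp only [gaussianTilt, ← Real.exp_add, inner_add_left]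
  rw [@norm_add_sq_real]
  ring_nf

lemma integrable_gaussianTilt_mul {d : ℕ} (u v : EuclideanSpace ℝ (Fin d)) :
    Integrable (fun x ↦ gaussianTilt u x * gaussianTilt v x)
      (stdGaussian (EuclideanSpace ℝ (Fin d))) := by
  simp_rw [gaussianTilt_mul]
  exact (integrable_gaussianTilt _).const_mul _

lemma integral_gaussianTilt_mul {d : ℕ} (u v : EuclideanSpace ℝ (Fin d)) :
    ∫ x, gaussianTilt u x * gaussianTilt v x ∂stdGaussian (EuclideanSpace ℝ (Fin d)) =
      Real.exp (inner ℝ u v) := by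
  simp_rw [gaussianTilt_mul, integral_const_mul, integral_gaussianTilt, mul_one]

lemma isProbabilityMeasure_withDensity_ofReal {α : Type*} [MeasurableSpace α] {μ : Measure α}
    {f : α → ℝ} (hf : Integrable f μ) (h0 : ∀ x, 0 ≤ f x) (h1 : ∫ x, f x ∂μ = 1) :
    IsProbabilityMeasure (μ.withDensity fun x ↦ ENNReal.ofReal (f x)) := by
  constructor
  rw [withDensity_apply _ .univ, Measure.restrict_univ,
    ← ofReal_integral_eq_lintegral_ofReal hf (.of_forall h0), h1, ENNReal.ofReal_one]

lemma map_add_stdGaussian {d : ℕ} (u : EuclideanSpace ℝ (Fin d)) :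
    (stdGaussian (EuclideanSpace ℝ (Fin d))).map (u + ·) =
      (stdGaussian _).withDensity fun x ↦ ENNReal.ofReal (gaussianTilt u x) := by
  have := isProbabilityMeasure_withDensity_ofReal (integrable_gaussianTilt u)
    (fun x ↦ (gaussianTilt_pos u x).le) (integral_gaussianTilt u)
  have hp : IsProbabilityMeasure ((stdGaussian (EuclideanSpace ℝ (Fin d))).map (u + ·)) :=
    Measure.isProbabilityMeasure_map (by fun_prop)
  apply Measure.ext_of_charFun
  ext t
  have hinner (x y : EuclideanSpace ℝ (Fin d)) :
      ((inner ℝ x y : ℝ) : ℂ) = ∑ i, (y i : ℂ) * x i := by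
    simp [PiLp.inner_apply]
  have hn (x : EuclideanSpace ℝ (Fin d)) : ((‖x‖ ^ 2 : ℝ) : ℂ) = ∑ i, (x i : ℂ) ^ 2 := by
    rw [EuclideanSpace.real_norm_sq_eq]; push_cast; rfl
  rw [charFun_apply, charFun_apply, integral_map (by fun_prop)
    (Measurable.aestronglyMeasurable (by fun_prop)),
    integral_withDensity_eq_integral_toReal_smul (by fun_prop) (by simp)]
  simp_rw [ENNReal.toReal_ofReal (gaussianTilt_pos u _).le, inner_add_left]
  have e1 (x : EuclideanSpace ℝ (Fin d)) :
      Complex.exp (((inner ℝ u t + inner ℝ x t : ℝ) : ℂ) * Complex.I) =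
      Complex.exp (∑ i, (u i : ℂ) * t i * Complex.I) *
        Complex.exp (∑ i, (t i * Complex.I) * x i) := by
    rw [← Complex.exp_add, Complex.ofReal_add, hinner, hinner, ← Finset.sum_add_distrib,
      ← Finset.sum_add_distrib, Finset.sum_mul]
    congr 1; apply Finset.sum_congr rfl; intro i _; ring
  have e2 (x : EuclideanSpace ℝ (Fin d)) :
      gaussianTilt u x • Complex.exp (((inner ℝ x t : ℝ) : ℂ) * Complex.I) =
      Complex.exp (-∑ i, (u i : ℂ) ^ 2 / 2) *
        Complex.exp (∑ i, (u i + t i * Complex.I) * x i) := by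
    rw [gaussianTilt, Complex.real_smul, Complex.ofReal_exp, ← Complex.exp_add, ← Complex.exp_add,
      Complex.ofReal_sub, Complex.ofReal_div, hinner, hinner, hn, ← Finset.sum_neg_distrib]
    congr 1
    push_cast
    rw [Finset.sum_div, Finset.sum_mul, ← Finset.sum_sub_distrib, ← Finset.sum_add_distrib,
      ← Finset.sum_add_distrib]
    apply Finset.sum_congr rfl; intro i _; ring
  simp_rw [e1, e2, integral_const_mul, integral_cexp_stdGaussian, ← Complex.exp_add]
  congr 1
  rw [← Finset.sum_neg_distrib, ← Finset.sum_add_distrib, ← Finset.sum_add_distrib]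
  apply Finset.sum_congr rfl; intro i _
  ring_nf

/-! ### Product measures and a Cauchy–Schwarz change of measure. -/

lemma lintegral_pi_prod {ι : Type*} [Fintype ι] {X : ι → Type*} [∀ i, MeasurableSpace (X i)]
    (ν : ∀ i, Measure (X i)) [∀ i, IsProbabilityMeasure (ν i)] {f : ∀ i, X i → ℝ≥0∞}
    (hf : ∀ i, Measurable (f i)) :
    ∫⁻ x, ∏ i, f i (x i) ∂Measure.pi ν = ∏ i, ∫⁻ x, f i x ∂ν i := by
  rw [lintegral_prod_eq_prod_lintegral_of_indepFun Finset.univ 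
    (fun i (x : ∀ i, X i) ↦ f i (x i))
    (iIndepFun_pi fun i ↦ (hf i).aemeasurable) fun i ↦ (hf i).comp (measurable_pi_apply i)]
  refine Finset.prod_congr rfl fun i _ ↦ ?_
  rw [← (measurePreserving_eval ν i).map_eq, lintegral_map (hf i) (measurable_pi_apply i)]

lemma pi_withDensity_eq {ι : Type*} [Fintype ι] {X : ι → Type*} [∀ i, MeasurableSpace (X i)]
    (ν : ∀ i, Measure (X i)) [∀ i, IsProbabilityMeasure (ν i)] {f : ∀ i, X i → ℝ≥0∞}
    (hf : ∀ i, Measurable (f i)) [∀ i, IsProbabilityMeasure ((ν i).withDensity (f i))] :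
    Measure.pi (fun i ↦ (ν i).withDensity (f i)) =
      (Measure.pi ν).withDensity fun x ↦ ∏ i, f i (x i) := by
  refine Measure.pi_eq fun s hs ↦ ?_
  rw [withDensity_apply _ (.univ_pi hs), ← lintegral_indicator (.univ_pi hs)]
  have : (Set.univ.pi s).indicator (fun x ↦ ∏ i, f i (x i)) =
      fun x ↦ ∏ i, (s i).indicator (f i) (x i) := by
    ext x
    classical
    by_cases h : x ∈ Set.univ.pi s
    · rw [Set.indicator_of_mem h]
      exact Finset.prod_congr rfl fun i _ ↦ (Set.indicator_of_mem (h i trivial) _).symm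
    · rw [Set.indicator_of_notMem h]
      simp only [Set.mem_univ_pi, not_forall] at h
      obtain ⟨i, hi⟩ := h
      exact (Finset.prod_eq_zero (Finset.mem_univ i) (Set.indicator_of_notMem hi _)).symm
  rw [this, lintegral_pi_prod ν fun i ↦ (hf i).indicator (hs i)]
  exact Finset.prod_congr rfl fun i _ ↦ by
    rw [lintegral_indicator (hs i), withDensity_apply _ (hs i)]

/-- Cauchy–Schwarz on `B` applied to `f = (f / √g) · √g`. -/
lemma sq_withDensity_apply_le {α : Type*} [MeasurableSpace α] (ν : Measure α) {f g : α → ℝ≥0∞}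
    (hf : Measurable f) (hg : Measurable g) (hg0 : ∀ x, g x ≠ 0) (hgt : ∀ x, g x ≠ ∞)
    {B : Set α} (hB : MeasurableSet B) :
    (ν.withDensity f B) ^ 2 ≤ ν.withDensity g B * ∫⁻ x, f x ^ 2 / g x ∂ν := by
  rw [withDensity_apply _ hB, withDensity_apply _ hB]
  have h := ENNReal.lintegral_mul_le_Lp_mul_Lq (ν.restrict B) Real.HolderConjugate.two_two
    (f := fun x ↦ f x / g x ^ (1 / 2 : ℝ)) (g := fun x ↦ g x ^ (1 / 2 : ℝ))
    (by fun_prop) (by fun_prop)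
  have hs (x : α) : (g x ^ (1 / 2 : ℝ)) ^ 2 = g x := by
    rw [← ENNReal.rpow_natCast, ← ENNReal.rpow_mul]; norm_num
  have e1 : ∫⁻ x in B, ((fun x ↦ f x / g x ^ (1 / 2 : ℝ)) * fun x ↦ g x ^ (1 / 2 : ℝ)) x ∂ν =
      ∫⁻ x in B, f x ∂ν := by
    refine lintegral_congr fun x ↦ ?_
    simp only [Pi.mul_apply]
    refine ENNReal.div_mul_cancel ?_ ?_
    · simp [hg0 x, hgt x]
    · simp [hg0 x, hgt x]
  have e2 (x : α) : (f x / g x ^ (1 / 2 : ℝ)) ^ (2 : ℝ) = f x ^ 2 / g x := by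
    rw [ENNReal.rpow_ofNat, div_eq_mul_inv, mul_pow, ← ENNReal.inv_pow, hs, div_eq_mul_inv]
  have e3 (x : α) : (g x ^ (1 / 2 : ℝ)) ^ (2 : ℝ) = g x := by
    rw [ENNReal.rpow_ofNat, hs]
  rw [e1] at h
  simp_rw [e2, e3] at h
  have hsq (a : ℝ≥0∞) : (a ^ (1 / 2 : ℝ)) ^ 2 = a := by
    rw [← ENNReal.rpow_natCast, ← ENNReal.rpow_mul]; norm_num
  calc (∫⁻ x in B, f x ∂ν) ^ 2 ≤ _ := pow_le_pow_left' h 2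
    _ = (∫⁻ x in B, f x ^ 2 / g x ∂ν) * ∫⁻ x in B, g x ∂ν := by
      rw [mul_pow, hsq, hsq]
    _ ≤ _ := by
      rw [mul_comm]
      gcongr
      exact Measure.restrict_le_self

/-! ### Gaussian mixtures and the law of the sample. -/

/-- The density of the Gaussian mixture `∑ i, w i • N(v i, I)` with respect to `N(0, I)`. -/
noncomputable def mixDensity {ι : Type*} [Fintype ι] {d : ℕ} (w : ι → ℝ≥0)
    (v : ι → EuclideanSpace ℝ (Fin d)) (x : EuclideanSpace ℝ (Fin d)) : ℝ :=
  ∑ i, (w i : ℝ) * gaussianTilt (v i) x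

section mixDensity

variable {ι : Type*} [Fintype ι] {d : ℕ} (w : ι → ℝ≥0) (v : ι → EuclideanSpace ℝ (Fin d))

lemma mixDensity_nonneg (x : EuclideanSpace ℝ (Fin d)) : 0 ≤ mixDensity w v x :=
  Finset.sum_nonneg fun i _ ↦ mul_nonneg (w i).2 (gaussianTilt_pos _ _).le

@[fun_prop]
lemma measurable_mixDensity : Measurable (mixDensity w v) := by
  unfold mixDensity; fun_prop

lemma integrable_mixDensity :
    Integrable (mixDensity w v) (stdGaussian (EuclideanSpace ℝ (Fin d))) :=
  integrable_finsetSum _ fun _ _ ↦ (integrable_gaussianTilt _).const_mul _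

lemma integral_mixDensity (hw : ∑ i, w i = 1) :
    ∫ x, mixDensity w v x ∂stdGaussian (EuclideanSpace ℝ (Fin d)) = 1 := by
  unfold mixDensity
  rw [integral_finsetSum _ fun _ _ ↦ (integrable_gaussianTilt _).const_mul _]
  simp_rw [integral_const_mul, integral_gaussianTilt, mul_one]
  exact_mod_cast hw

/-- Since `exp s ≥ 1 + s` and the linear terms average to zero, a centred mixture has density
bounded below uniformly. This removes the denominator from the chi-square integral. -/
lemma exp_neg_le_mixDensity (hw : ∑ i, w i = 1) (hmean : ∑ i, (w i : ℝ) • v i = 0)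
    (hv : ∀ i, ‖v i‖ ≤ 1) (x : EuclideanSpace ℝ (Fin d)) :
    Real.exp (-(1 / 2)) ≤ mixDensity w v x := by
  have hw' : ∑ i, (w i : ℝ) = 1 := by exact_mod_cast hw
  have hin : ∑ i, (w i : ℝ) * inner ℝ (v i) x = 0 := by
    have : inner ℝ (∑ i, (w i : ℝ) • v i) x = 0 := by rw [hmean, inner_zero_left]
    simpa [sum_inner, inner_smul_left] using this
  have key (i : ι) : Real.exp (-(1 / 2)) * (inner ℝ (v i) x + 1) ≤ gaussianTilt (v i) x := by
    have h1 : gaussianTilt (v i) x = Real.exp (-(1 / 2)) *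
        Real.exp (inner ℝ (v i) x + (1 - ‖v i‖ ^ 2) / 2) := by
      rw [gaussianTilt, ← Real.exp_add]; ring_nf
    rw [h1]
    gcongr
    refine le_trans ?_ (Real.add_one_le_exp _)
    have : ‖v i‖ ^ 2 ≤ 1 := pow_le_one₀ (norm_nonneg _) (hv i)
    linarith
  calc Real.exp (-(1 / 2)) = ∑ i, (w i : ℝ) * (Real.exp (-(1 / 2)) * (inner ℝ (v i) x + 1)) := by
        have (i : ι) : (w i : ℝ) * (Real.exp (-(1 / 2)) * (inner ℝ (v i) x + 1)) =
          Real.exp (-(1 / 2)) * ((w i : ℝ) * inner ℝ (v i) x + w i) := by ring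
        simp_rw [this, ← Finset.mul_sum, Finset.sum_add_distrib, hin, hw']; ring
    _ ≤ _ := Finset.sum_le_sum fun i _ ↦ mul_le_mul_of_nonneg_left (key i) (w i).2

/-- Rescaling by `σ` moves the noise level into the nodes, so that all samples share the reference
measure `N(0, I)`. -/
lemma conv_isotropicGaussian_eq {σ : ℝ} (hσ : σ ≠ 0) :
    (∑ i, w i • Measure.dirac (v i)).conv (isotropicGaussian d σ) =
      ((stdGaussian (EuclideanSpace ℝ (Fin d))).withDensity fun x ↦
        ENNReal.ofReal (mixDensity w (fun i ↦ σ⁻¹ • v i) x)).map (σ • ·) := by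
  have : IsProbabilityMeasure (isotropicGaussian d σ) := by
    unfold isotropicGaussian
    exact Measure.isProbabilityMeasure_map (by fun_prop)
  have hms : Measurable (fun z : EuclideanSpace ℝ (Fin d) ↦ σ • z) := by fun_prop
  ext s hs
  have hm : Measurable (s.indicator (1 : EuclideanSpace ℝ (Fin d) → ℝ≥0∞)) :=
    measurable_one.indicator hs
  have hs' : MeasurableSet ((fun z : EuclideanSpace ℝ (Fin d) ↦ σ • z) ⁻¹' s) := hms hs
  rw [← lintegral_indicator_one hs, Measure.lintegral_conv hm, lintegral_finsetSum_measure,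
    Measure.map_apply hms hs, withDensity_apply _ hs']
  have e1 (x : EuclideanSpace ℝ (Fin d)) :
      ENNReal.ofReal (mixDensity w (fun i ↦ σ⁻¹ • v i) x) =
        ∑ i, (w i : ℝ≥0∞) * ENNReal.ofReal (gaussianTilt (σ⁻¹ • v i) x) := by
    rw [mixDensity, ENNReal.ofReal_sum_of_nonneg
      (f := fun i ↦ (w i : ℝ) * gaussianTilt (σ⁻¹ • v i) x) fun i _ ↦ mul_nonneg (w i).2 (gaussianTilt_pos _ _).le]
    refine Finset.sum_congr rfl fun i _ ↦ ?_
    rw [ENNReal.ofReal_mul NNReal.zero_le_coe, ENNReal.ofReal_coe_nnreal]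
  simp_rw [e1]
  rw [lintegral_finsetSum _ fun i _ ↦ by fun_prop]
  refine Finset.sum_congr rfl fun i _ ↦ ?_
  rw [lintegral_const_mul _ (by fun_prop), ← withDensity_apply _ hs', ← map_add_stdGaussian,
    Measure.map_apply (by fun_prop) hs', lintegral_smul_measure, lintegral_dirac,
    isotropicGaussian, lintegral_map
      (f := fun y ↦ s.indicator (1 : EuclideanSpace ℝ (Fin d) → ℝ≥0∞) (v i + y))
      (hm.comp (by fun_prop)) hms, ENNReal.smul_def, smul_eq_mul]
  congr 1
  have : (fun z : EuclideanSpace ℝ (Fin d) ↦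
      s.indicator (1 : EuclideanSpace ℝ (Fin d) → ℝ≥0∞) (v i + σ • z)) =
      ((σ⁻¹ • v i + ·) ⁻¹' ((fun z : EuclideanSpace ℝ (Fin d) ↦ σ • z) ⁻¹' s)).indicator 1 := by
    ext z
    have hmem : z ∈ (σ⁻¹ • v i + ·) ⁻¹' ((fun z : EuclideanSpace ℝ (Fin d) ↦ σ • z) ⁻¹' s) ↔
        v i + σ • z ∈ s := by
      rw [Set.mem_preimage, Set.mem_preimage, smul_add, smul_inv_smul₀ hσ]
    by_cases h : v i + σ • z ∈ s
    · rw [Set.indicator_of_mem h, Set.indicator_of_mem (hmem.2 h), Pi.one_apply, Pi.one_apply]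
    · rw [Set.indicator_of_notMem h, Set.indicator_of_notMem (mt hmem.1 h)]
  rw [this, lintegral_indicator_one ((measurable_const_add _) hs')]

end mixDensity

lemma measurable_prod_mixDensity {ι : Type*} [Fintype ι] {n d : ℕ} (σ : Fin n → ℝ)
    (w : ι → ℝ≥0) (v : ι → EuclideanSpace ℝ (Fin d)) :
    Measurable fun x : Fin n → EuclideanSpace ℝ (Fin d) ↦
      ∏ j, ENNReal.ofReal (mixDensity w (fun i ↦ (σ j)⁻¹ • v i) (x j)) := by
  fun_prop

lemma sampleLaw_eq_map {ι : Type*} [Fintype ι] {n d : ℕ} {σ : Fin n → ℝ} (hσ : ∀ j, σ j ≠ 0)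
    {w : ι → ℝ≥0} {v : ι → EuclideanSpace ℝ (Fin d)} (hw : ∑ i, w i = 1) :
    sampleLaw σ (∑ i, w i • Measure.dirac (v i)) =
      ((Measure.pi fun _ : Fin n ↦ stdGaussian (EuclideanSpace ℝ (Fin d))).withDensity
        fun x ↦ ∏ j, ENNReal.ofReal (mixDensity w (fun i ↦ (σ j)⁻¹ • v i) (x j))).map
          fun x j ↦ σ j • x j := by
  have (j : Fin n) := isProbabilityMeasure_withDensity_ofReal
    (integrable_mixDensity w (fun i ↦ (σ j)⁻¹ • v i)) (mixDensity_nonneg w _)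
    (integral_mixDensity w _ hw)
  have (j : Fin n) := Measure.isProbabilityMeasure_map
    (μ := (stdGaussian (EuclideanSpace ℝ (Fin d))).withDensity fun x ↦
      ENNReal.ofReal (mixDensity w (fun i ↦ (σ j)⁻¹ • v i) x))
    (f := fun x ↦ σ j • x) (by fun_prop)
  rw [← pi_withDensity_eq (fun _ ↦ stdGaussian (EuclideanSpace ℝ (Fin d)))
      (f := fun j x ↦ ENNReal.ofReal (mixDensity w (fun i ↦ (σ j)⁻¹ • v i) x))
      (fun j ↦ by fun_prop), Measure.pi_map_pi (f := fun j x ↦ σ j • x) fun j ↦ by fun_prop,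
    sampleLaw]
  simp_rw [conv_isotropicGaussian_eq w v (hσ _)]

lemma sq_sampleLaw_le {ι κ : Type*} [Fintype ι] [Fintype κ] {n d : ℕ} {σ : Fin n → ℝ}
    (hσ : ∀ j, σ j ≠ 0) {w : ι → ℝ≥0} {v : ι → EuclideanSpace ℝ (Fin d)}
    {w' : κ → ℝ≥0} {v' : κ → EuclideanSpace ℝ (Fin d)} (hw : ∑ i, w i = 1) (hw' : ∑ i, w' i = 1)
    {a : Fin n → ℝ}
    (hpos : ∀ j x, 0 < mixDensity w' (fun i ↦ (σ j)⁻¹ • v' i) x)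
    (ha : ∀ j, ∫⁻ x, ENNReal.ofReal (mixDensity w (fun i ↦ (σ j)⁻¹ • v i) x) ^ 2 /
      ENNReal.ofReal (mixDensity w' (fun i ↦ (σ j)⁻¹ • v' i) x)
        ∂stdGaussian (EuclideanSpace ℝ (Fin d)) ≤ ENNReal.ofReal (Real.exp (a j)))
    {B : Set (Fin n → EuclideanSpace ℝ (Fin d))} (hB : MeasurableSet B) :
    sampleLaw σ (∑ i, w i • Measure.dirac (v i)) B ^ 2 ≤
      sampleLaw σ (∑ i, w' i • Measure.dirac (v' i)) B * ENNReal.ofReal (Real.exp (∑ j, a j)) := by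
  have hS : Measurable (fun (x : Fin n → EuclideanSpace ℝ (Fin d)) j ↦ σ j • x j) := by fun_prop
  rw [sampleLaw_eq_map hσ hw, sampleLaw_eq_map hσ hw', Measure.map_apply hS hB, Measure.map_apply hS hB]
  refine (sq_withDensity_apply_le _ (measurable_prod_mixDensity σ w v)
    (measurable_prod_mixDensity σ w' v') ?_ ?_ (hS hB)).trans ?_
  · intro x
    exact Finset.prod_ne_zero_iff.2 fun j _ ↦ (ENNReal.ofReal_pos.2 (hpos j _)).ne'
  · intro x
    exact ENNReal.prod_ne_top fun j _ ↦ ENNReal.ofReal_ne_top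
  · gcongr
    have e (x : Fin n → EuclideanSpace ℝ (Fin d)) :
        (∏ j, ENNReal.ofReal (mixDensity w (fun i ↦ (σ j)⁻¹ • v i) (x j))) ^ 2 /
          ∏ j, ENNReal.ofReal (mixDensity w' (fun i ↦ (σ j)⁻¹ • v' i) (x j)) =
        ∏ j, (ENNReal.ofReal (mixDensity w (fun i ↦ (σ j)⁻¹ • v i) (x j)) ^ 2 /
          ENNReal.ofReal (mixDensity w' (fun i ↦ (σ j)⁻¹ • v' i) (x j))) := by
      rw [← Finset.prod_pow, ENNReal.prod_div_distrib]
      exact fun i _ j _ _ ↦ by simp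
    simp_rw [e]
    rw [lintegral_pi_prod (fun _ ↦ stdGaussian (EuclideanSpace ℝ (Fin d)))
      (f := fun j x ↦ ENNReal.ofReal (mixDensity w (fun i ↦ (σ j)⁻¹ • v i) x) ^ 2 /
        ENNReal.ofReal (mixDensity w' (fun i ↦ (σ j)⁻¹ • v' i) x)) (fun j ↦ by fun_prop),
      Real.exp_sum, ENNReal.ofReal_prod_of_nonneg fun j _ ↦ (Real.exp_pos _).le]
    exact Finset.prod_le_prod' fun j _ ↦ ha j

/-! ### Chi-square bounds from matching moments. -/

lemma integral_sq_sum_gaussianTilt {ι : Type*} [Fintype ι] {d : ℕ} (c : ι → ℝ)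
    (v : ι → EuclideanSpace ℝ (Fin d)) :
    Integrable (fun x ↦ (∑ i, c i * gaussianTilt (v i) x) ^ 2) (stdGaussian _) ∧
    ∫ x, (∑ i, c i * gaussianTilt (v i) x) ^ 2 ∂stdGaussian (EuclideanSpace ℝ (Fin d)) =
      ∑ i, ∑ j, c i * c j * Real.exp (inner ℝ (v i) (v j)) := by
  have e (x : EuclideanSpace ℝ (Fin d)) : (∑ i, c i * gaussianTilt (v i) x) ^ 2 =
      ∑ i, ∑ j, c i * c j * (gaussianTilt (v i) x * gaussianTilt (v j) x) := by
    rw [sq, Finset.sum_mul_sum]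
    exact Finset.sum_congr rfl fun i _ ↦ Finset.sum_congr rfl fun j _ ↦ by ring
  have hi (i j : ι) := (integrable_gaussianTilt_mul (v i) (v j)).const_mul (c i * c j)
  simp_rw [e]
  refine ⟨integrable_finsetSum _ fun i _ ↦ integrable_finsetSum _ fun j _ ↦ hi i j, ?_⟩
  rw [integral_finsetSum _ fun i _ ↦ integrable_finsetSum _ fun j _ ↦ hi i j]
  refine Finset.sum_congr rfl fun i _ ↦ ?_
  rw [integral_finsetSum _ fun j _ ↦ hi i j]
  simp_rw [integral_const_mul, integral_gaussianTilt_mul]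

/-- A quadratic form of the exponential kernel whose first `m` moments vanish is small. -/
lemma sum_sum_mul_exp_le {ι : Type*} [Fintype ι] {c y : ι → ℝ} {m : ℕ} {t : ℝ}
    (ht0 : 0 ≤ t) (ht1 : t ≤ 1) (hy : ∀ i, |y i| ≤ 1) (hc : ∑ i, |c i| ≤ 2)
    (hmom : ∀ l < m, ∑ i, c i * y i ^ l = 0) :
    ∑ i, ∑ j, c i * c j * Real.exp (t * y i * (t * y j)) ≤ 4 * Real.exp 1 * t ^ (2 * m) := by
  have hs : HasSum (fun l : ℕ ↦ ∑ i, ∑ j, c i * c j * ((t * y i * (t * y j)) ^ l / l.factorial))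
      (∑ i, ∑ j, c i * c j * Real.exp (t * y i * (t * y j))) :=
    hasSum_sum fun i _ ↦ hasSum_sum fun j _ ↦ by
      have := NormedSpace.expSeries_div_hasSum_exp (𝔸 := ℝ) (t * y i * (t * y j))
      rw [← Real.exp_eq_exp_ℝ] at this
      exact this.mul_left _
  have hr : HasSum (fun l : ℕ ↦ 4 * t ^ (2 * m) * ((1 : ℝ) ^ l / l.factorial))
      (4 * t ^ (2 * m) * Real.exp 1) := by
    have := NormedSpace.expSeries_div_hasSum_exp (𝔸 := ℝ) 1
    rw [← Real.exp_eq_exp_ℝ] at this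
    exact this.mul_left _
  rw [mul_right_comm]
  refine hasSum_le (fun l ↦ ?_) hs hr
  -- The kernel `(t yᵢ · t yⱼ)^l` has rank one, so each Taylor term is the square of an `l`-th
  -- moment.
  have e : ∑ i, ∑ j, c i * c j * ((t * y i * (t * y j)) ^ l / l.factorial) =
      t ^ (2 * l) / l.factorial * (∑ i, c i * y i ^ l) ^ 2 := by
    rw [sq, Finset.sum_mul_sum, Finset.mul_sum]
    refine Finset.sum_congr rfl fun i _ ↦ ?_
    rw [Finset.mul_sum]
    exact Finset.sum_congr rfl fun j _ ↦ by rw [mul_pow, mul_pow, mul_pow, two_mul, pow_add]; ring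
  rw [e]
  by_cases hl : l < m
  · rw [hmom l hl]; simp only [ne_eq, OfNat.ofNat_ne_zero, not_false_eq_true, zero_pow, mul_zero]
    positivity
  · have h2 : (∑ i, c i * y i ^ l) ^ 2 ≤ 4 := by
      have : |∑ i, c i * y i ^ l| ≤ 2 := by
        refine (Finset.abs_sum_le_sum_abs _ _).trans (le_trans ?_ hc)
        refine Finset.sum_le_sum fun i _ ↦ ?_
        rw [abs_mul, abs_pow]
        exact mul_le_of_le_one_right (abs_nonneg _) (pow_le_one₀ (abs_nonneg _) (hy i))
      nlinarith [abs_le.1 this]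
    have h1 : t ^ (2 * l) ≤ t ^ (2 * m) := pow_le_pow_of_le_one ht0 ht1 (by omega)
    calc t ^ (2 * l) / l.factorial * (∑ i, c i * y i ^ l) ^ 2
        ≤ t ^ (2 * m) / l.factorial * 4 := by gcongr
      _ = _ := by rw [one_pow]; ring

lemma lintegral_sq_div_le {α : Type*} [MeasurableSpace α] {μ : Measure α} {f g : α → ℝ} {b : ℝ}
    (hf0 : ∀ x, 0 ≤ f x) (hb : 0 < b) (hg : ∀ x, b⁻¹ ≤ g x) (hf : Integrable f μ)
    (hgi : Integrable g μ) (hfg : Integrable (fun x ↦ (f x - g x) ^ 2) μ)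
    (hf1 : ∫ x, f x ∂μ = 1) (hg1 : ∫ x, g x ∂μ = 1) :
    ∫⁻ x, ENNReal.ofReal (f x) ^ 2 / ENNReal.ofReal (g x) ∂μ ≤
      ENNReal.ofReal (1 + b * ∫ x, (f x - g x) ^ 2 ∂μ) := by
  have hgp (x : α) : 0 < g x := (inv_pos.2 hb).trans_le (hg x)
  -- Exactly, `f² / g = 2f - g + (f - g)² / g`, and `1 / g ≤ b`.
  have key (x : α) : f x ^ 2 / g x ≤ 2 * f x - g x + b * (f x - g x) ^ 2 := by
    have h1 : 1 ≤ b * g x := by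
      have := mul_le_mul_of_nonneg_left (hg x) hb.le
      rwa [mul_inv_cancel₀ hb.ne'] at this
    rw [div_le_iff₀ (hgp x)]
    nlinarith [mul_nonneg (sub_nonneg.2 h1) (sq_nonneg (f x - g x))]
  have hi' : Integrable (fun x ↦ 2 * f x - g x) μ := (hf.const_mul 2).sub hgi
  have hi : Integrable (fun x ↦ 2 * f x - g x + b * (f x - g x) ^ 2) μ :=
    hi'.add (hfg.const_mul b)
  have hint : ∫ x, (2 * f x - g x + b * (f x - g x) ^ 2) ∂μ =
      1 + b * ∫ x, (f x - g x) ^ 2 ∂μ := by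
    rw [integral_add hi' (hfg.const_mul b),
      integral_sub (hf.const_mul 2) hgi, integral_const_mul, integral_const_mul, hf1, hg1]
    norm_num
  rw [← hint, ofReal_integral_eq_lintegral_ofReal hi
    (.of_forall fun x ↦ le_trans (div_nonneg (sq_nonneg _) (hgp x).le) (key x))]
  refine lintegral_mono fun x ↦ ?_
  rw [← ENNReal.ofReal_pow (hf0 x), ← ENNReal.ofReal_div_of_pos (hgp x)]
  exact ENNReal.ofReal_le_ofReal (key x)

lemma four_mul_exp_mul_exp_le : Real.exp (1 / 2) * (4 * Real.exp 1) ≤ 20 := by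
  have h1 := Real.exp_one_lt_d9
  have h2 : Real.exp (1 / 2) ^ 2 = Real.exp 1 := by
    rw [← Real.exp_nat_mul]; norm_num
  have h3 : Real.exp (1 / 2) ≤ 1.7 := by
    by_contra h
    push Not at h
    nlinarith
  have := Real.exp_pos 1
  nlinarith

/-- The chi-square bound for mixtures located on a line whose first `m` moments agree. -/
lemma sq_sampleLaw_le_of_moments_eq {ι κ : Type*} [Fintype ι] [Fintype κ] {n d m : ℕ}
    {σ : Fin n → ℝ} (hσ : ∀ j, 1 ≤ σ j) {e : EuclideanSpace ℝ (Fin d)} (he : ‖e‖ = 1) {η : ℝ}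
    (hη0 : 0 ≤ η) (hη1 : η ≤ 1)
    {w : ι → ℝ≥0} {y : ι → ℝ} {w' : κ → ℝ≥0} {y' : κ → ℝ} (hw : ∑ i, w i = 1)
    (hw' : ∑ i, w' i = 1) (hy : ∀ i, |y i| ≤ 1) (hy' : ∀ i, |y' i| ≤ 1)
    (hmean : ∑ i, (w' i : ℝ) * y' i = 0)
    (hmom : ∀ l < m, ∑ i, (w i : ℝ) * y i ^ l = ∑ i, (w' i : ℝ) * y' i ^ l)
    {a : ℝ} (ha : 20 * η ^ (2 * m) * ∑ j, 1 / σ j ^ (2 * m) ≤ a)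
    {B : Set (Fin n → EuclideanSpace ℝ (Fin d))} (hB : MeasurableSet B) :
    sampleLaw σ (∑ i, w i • Measure.dirac ((η * y i) • e)) B ^ 2 ≤
      sampleLaw σ (∑ i, w' i • Measure.dirac ((η * y' i) • e)) B *
        ENNReal.ofReal (Real.exp a) := by
  have hσ0 (j : Fin n) : 0 < σ j := zero_lt_one.trans_le (hσ j)
  have ht1 (j : Fin n) : η / σ j ≤ 1 := by
    rw [div_le_one (hσ0 j)]; exact hη1.trans (hσ j)
  have ht0 (j : Fin n) : 0 ≤ η / σ j := div_nonneg hη0 (hσ0 j).le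
  have hlow (j : Fin n) (x : EuclideanSpace ℝ (Fin d)) :
      (Real.exp (1 / 2))⁻¹ ≤ mixDensity w' (fun i ↦ (σ j)⁻¹ • (η * y' i) • e) x := by
    rw [← Real.exp_neg]
    refine exp_neg_le_mixDensity _ _ hw' ?_ (fun i ↦ ?_) x
    · have h (i : κ) : (w' i : ℝ) • (σ j)⁻¹ • (η * y' i) • e =
          ((w' i : ℝ) * y' i) • ((σ j)⁻¹ * η) • e := by
        simp only [smul_smul]; ring_nf
      simp_rw [h, ← Finset.sum_smul, hmean, zero_smul]
    · rw [norm_smul, norm_smul, he, mul_one, Real.norm_eq_abs, Real.norm_eq_abs, abs_mul,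
        abs_of_nonneg hη0, abs_of_pos (inv_pos.2 (hσ0 j)), ← mul_assoc, mul_comm _ η,
        ← div_eq_mul_inv]
      exact mul_le_one₀ (ht1 j) (abs_nonneg _) (hy' i)
  refine (sq_sampleLaw_le (fun j ↦ (hσ0 j).ne') hw hw' (a := fun j ↦ 20 * (η / σ j) ^ (2 * m))
    (fun j x ↦ (inv_pos.2 (Real.exp_pos _)).trans_le (hlow j x)) (fun j ↦ ?_) hB).trans ?_
  -- The difference of the mixtures is one signed mixture of total mass at most 2 whose moments of
  -- order below `m` vanish.
  · let c : ι ⊕ κ → ℝ := Sum.elim (fun i ↦ (w i : ℝ)) fun i ↦ -(w' i : ℝ)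
    let z : ι ⊕ κ → ℝ := Sum.elim y y'
    have hdiff (x : EuclideanSpace ℝ (Fin d)) :
        mixDensity w (fun i ↦ (σ j)⁻¹ • (η * y i) • e) x -
          mixDensity w' (fun i ↦ (σ j)⁻¹ • (η * y' i) • e) x =
        ∑ i, c i * gaussianTilt ((η / σ j * z i) • e) x := by
      have h (r : ℝ) : (σ j)⁻¹ • (η * r) • e = (η / σ j * r) • e := by
        rw [smul_smul]; ring_nf
      simp [mixDensity, c, z, h, sub_eq_add_neg]
    obtain ⟨hi, hint⟩ := integral_sq_sum_gaussianTilt c fun i ↦ (η / σ j * z i) • e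
    refine (lintegral_sq_div_le (mixDensity_nonneg _ _) (Real.exp_pos _) (hlow j)
      (integrable_mixDensity _ _) (integrable_mixDensity _ _) (by simp_rw [hdiff]; exact hi)
      (integral_mixDensity _ _ hw) (integral_mixDensity _ _ hw')).trans ?_
    apply ENNReal.ofReal_le_ofReal
    simp_rw [hdiff]
    rw [hint]
    have hinner (r s : ℝ) : inner ℝ (r • e) (s • e) = r * s := by
      rw [inner_smul_left, inner_smul_right, real_inner_self_eq_norm_sq, he]; simp
    simp_rw [hinner]
    have hb := sum_sum_mul_exp_le (c := c) (y := z) (m := m) (ht0 j) (ht1 j)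
      (by rintro (i | i) <;> simp [z, hy, hy'])
      (by
        have h1 : ∑ i, (w i : ℝ) = 1 := by exact_mod_cast hw
        have h2 : ∑ i, (w' i : ℝ) = 1 := by exact_mod_cast hw'
        simp [c, h1, h2]; norm_num)
      (fun l hl ↦ by simp [c, z, hmom l hl])
    have hpow : 0 ≤ (η / σ j) ^ (2 * m) := by have := ht0 j; positivity
    have := mul_le_mul_of_nonneg_left hb (Real.exp_pos (1 / 2)).le
    have h20 := mul_le_mul_of_nonneg_right four_mul_exp_mul_exp_le hpow
    have := Real.add_one_le_exp (20 * (η / σ j) ^ (2 * m))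
    linarith
  · gcongr
    refine le_of_eq_of_le ?_ ha
    rw [Finset.mul_sum]
    exact Finset.sum_congr rfl fun j _ ↦ by rw [div_pow]; ring

/-! ### Separation in Wasserstein distance. -/

/-- Under any coupling the second point lies in `S`, so the transport cost is at least the distance
to `S`. -/
lemma lintegral_infEDist_le_wasserstein {E : Type*} [NormedAddCommGroup E] [MeasurableSpace E]
    [OpensMeasurableSpace E] {μ ν : Measure E} {S : Set E} (hS : ∀ᵐ y ∂ν, y ∈ S) :
    ∫⁻ x, Metric.infEDist x S ∂μ ≤ wasserstein μ ν := by
  refine le_iInf₂ fun π hπ ↦ ?_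
  rw [← hπ.1, lintegral_map measurable_infEDist measurable_fst]
  rw [← hπ.2] at hS
  refine lintegral_mono_ae ?_
  filter_upwards [ae_of_ae_map measurable_snd.aemeasurable hS] with p hp
  rw [← edist_eq_enorm_sub]
  exact Metric.infEDist_le_edist_of_mem hp

lemma le_wasserstein_add_wasserstein {E : Type*} [NormedAddCommGroup E] [MeasurableSpace E]
    [OpensMeasurableSpace E] {μ ν ν' : Measure E} [IsProbabilityMeasure μ] {S S' : Set E}
    {g : ℝ≥0∞} (hS : ∀ᵐ y ∂ν, y ∈ S) (hS' : ∀ᵐ y ∂ν', y ∈ S')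
    (hg : ∀ x ∈ S, ∀ y ∈ S', g ≤ edist x y) :
    g ≤ wasserstein μ ν + wasserstein μ ν' := by
  calc g = ∫⁻ _, g ∂μ := by simp
    _ ≤ ∫⁻ x, (Metric.infEDist x S + Metric.infEDist x S') ∂μ := by
      refine lintegral_mono fun x ↦ ?_
      rw [← tsub_le_iff_left, Metric.le_infEDist]
      intro y hy
      rw [tsub_le_iff_left, add_comm]
      refine le_trans (Metric.le_infEDist.2 fun z hz ↦ ?_)
        (Metric.infEDist_le_edist_add_infEDist (x := y) (y := x) (s := S) |>.trans_eq
          (by rw [edist_comm]))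
      rw [edist_comm]
      exact hg z hz y hy
    _ = _ := lintegral_add_left measurable_infEDist _
    _ ≤ _ := add_le_add (lintegral_infEDist_le_wasserstein hS)
      (lintegral_infEDist_le_wasserstein hS')

section atomic

variable {ι E : Type*} [Fintype ι] [MeasurableSpace E] {w : ι → ℝ≥0} {m : ι → E}

lemma isProbabilityMeasure_sum_dirac (hw : ∑ i, w i = 1) :
    IsProbabilityMeasure (∑ i, w i • Measure.dirac (m i)) := by
  constructor
  simp only [Measure.coe_finsetSum, Finset.sum_apply, Measure.smul_apply, measure_univ,
    ENNReal.smul_def, smul_eq_mul, mul_one]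
  exact_mod_cast hw

lemma ae_mem_sum_dirac {S : Set E} (hS : MeasurableSet S) (h : ∀ i, m i ∈ S) :
    ∀ᵐ x ∂(∑ i, w i • Measure.dirac (m i)), x ∈ S := by
  rw [ae_iff]
  change (∑ i, w i • Measure.dirac (m i)) Sᶜ = 0
  simp [hS.compl, h]

end atomic

instance isProbabilityMeasure_isotropicGaussian {d : ℕ} {σ : ℝ} :
    IsProbabilityMeasure (isotropicGaussian d σ) :=
  Measure.isProbabilityMeasure_map (by fun_prop)

instance isProbabilityMeasure_sampleLaw {n d : ℕ} {σ : Fin n → ℝ}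
    {D : Measure (EuclideanSpace ℝ (Fin d))} [IsProbabilityMeasure D] :
    IsProbabilityMeasure (sampleLaw σ D) := by
  unfold sampleLaw; infer_instance

/-! ### Testing arguments: two points, and many points against one. -/

/-- Estimators are arbitrary maps, so their error events are replaced by measurable hulls. -/
lemma one_sub_le_compl_toMeasurable {Ω : Type*} [MeasurableSpace Ω] {P : Measure Ω}
    [IsProbabilityMeasure P] {A : Set Ω} {δ : ℝ} (hA : P A < ENNReal.ofReal δ) :
    1 - δ ≤ P.real (toMeasurable P A)ᶜ := by
  rw [probReal_compl_eq_one_sub (measurableSet_toMeasurable P A)]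
  have : P.real (toMeasurable P A) ≤ δ := by
    rw [measureReal_def, measure_toMeasurable]
    have hδ : 0 < δ := ENNReal.ofReal_pos.1 (bot_le.trans_lt hA)
    exact ENNReal.toReal_le_of_le_ofReal hδ.le hA.le
  linarith

lemma sq_measureReal_le {Ω : Type*} [MeasurableSpace Ω] {P Q : Measure Ω}
    [IsProbabilityMeasure P] [IsProbabilityMeasure Q] {R : ℝ} (hR : 0 ≤ R) {B : Set Ω}
    (h : P B ^ 2 ≤ Q B * ENNReal.ofReal R) : P.real B ^ 2 ≤ Q.real B * R := by
  have := ENNReal.toReal_mono (ENNReal.mul_ne_top (measure_ne_top _ _) ENNReal.ofReal_ne_top) h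
  rwa [ENNReal.toReal_pow, ENNReal.toReal_mul, ENNReal.toReal_ofReal hR] at this

/-- Le Cam's two point method for arbitrary, possibly non-measurable, events. -/
lemma le_measure_or_le_measure_of_sq_le {Ω : Type*} [MeasurableSpace Ω] {P Q : Measure Ω}
    [IsProbabilityMeasure P] [IsProbabilityMeasure Q] {A A' : Set Ω} (hA : A ∪ A' = Set.univ)
    {δ R : ℝ} (hδ0 : 0 < δ) (hδ : δ ≤ 1 / 4) (hR0 : 0 ≤ R) (hR : δ * R ≤ 1 / 2)
    (h : ∀ B, MeasurableSet B → P B ^ 2 ≤ Q B * ENNReal.ofReal R) :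
    ENNReal.ofReal δ ≤ P A ∨ ENNReal.ofReal δ ≤ Q A' := by
  by_contra! hcon
  have hB := measurableSet_toMeasurable P A
  have h1 := one_sub_le_compl_toMeasurable hcon.1
  have h2 : Q.real (toMeasurable P A)ᶜ ≤ δ := by
    rw [measureReal_def]
    refine ENNReal.toReal_le_of_le_ofReal hδ0.le (le_trans (measure_mono ?_) hcon.2.le)
    intro x hx
    have hx' : x ∈ A ∪ A' := hA ▸ Set.mem_univ x
    exact hx'.resolve_left fun hxA ↦ hx (subset_toMeasurable P A hxA)
  have h3 := sq_measureReal_le hR0 (h _ hB.compl)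
  have h4 := mul_le_mul_of_nonneg_right h2 hR0
  -- Here `9/16 ≤ (1 - δ)² ≤ δ R ≤ 1/2`, a contradiction.
  nlinarith

/-- If few of the events `(A v)ᶜ` occur simultaneously, then some `A v` has probability at least
`1 / 4` under `P v`. -/
lemma exists_le_measure_of_card_le {Ω V : Type*} [MeasurableSpace Ω] [Fintype V] [Nonempty V]
    {P : V → Measure Ω} {Q : Measure Ω} [∀ v, IsProbabilityMeasure (P v)]
    [IsProbabilityMeasure Q] {A : V → Set Ω} {N R : ℝ} (hR0 : 0 ≤ R)
    (hN : ∀ x, ((Set.ncard {v | x ∉ A v} : ℕ) : ℝ) ≤ N) (hNR : N * R ≤ Fintype.card V / 2)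
    (h : ∀ v B, MeasurableSet B → P v B ^ 2 ≤ Q B * ENNReal.ofReal R) :
    ∃ v, ENNReal.ofReal (1 / 4) ≤ P v (A v) := by
  by_contra! hcon
  let B (v : V) : Set Ω := (toMeasurable (P v) (A v))ᶜ
  have hB (v : V) : MeasurableSet (B v) := (measurableSet_toMeasurable _ _).compl
  have h1 (v : V) : 9 / 16 ≤ Q.real (B v) * R := by
    have h1 := one_sub_le_compl_toMeasurable (hcon v)
    have h2 := sq_measureReal_le hR0 (h v _ (hB v))
    change 1 - 1 / 4 ≤ (P v).real (B v) at h1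
    nlinarith
  -- At most `N` of the `B v` contain any given point; integrate this count against `Q`.
  have h2 : ∑ v, Q.real (B v) ≤ N := by
    have hi (v : V) : Integrable ((B v).indicator (1 : Ω → ℝ)) Q :=
      (integrable_const (1 : ℝ)).indicator (hB v)
    calc ∑ v, Q.real (B v) = ∫ x, ∑ v, (B v).indicator (1 : Ω → ℝ) x ∂Q := by
          rw [integral_finsetSum _ fun v _ ↦ hi v]
          exact Finset.sum_congr rfl fun v _ ↦ (integral_indicator_one (hB v)).symm
      _ ≤ ∫ _, N ∂Q := by
        refine integral_mono (integrable_finsetSum _ fun v _ ↦ hi v) (integrable_const _)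
          fun x ↦ le_trans ?_ (hN x)
        classical
        have : ∑ v, (B v).indicator (1 : Ω → ℝ) x = ((Finset.univ.filter (x ∈ B ·)).card : ℝ) := by
          rw [Finset.card_filter]
          push_cast
          exact Finset.sum_congr rfl fun v _ ↦ by simp [Set.indicator]
        simp only [this, Nat.cast_le]
        rw [← Set.ncard_coe_finset]
        refine Set.ncard_le_ncard (fun v hv ↦ ?_) (Set.toFinite _)
        simp only [Finset.coe_filter, Finset.mem_univ, true_and, Set.mem_ofPred_eq] at hv
        exact fun hA ↦ hv (subset_toMeasurable _ _ hA)
      _ = N := by simp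
  have h3 : Fintype.card V * (9 / 16 : ℝ) ≤ N * R := by
    calc Fintype.card V * (9 / 16 : ℝ) = ∑ _v : V, (9 / 16 : ℝ) := by simp
      _ ≤ ∑ v, Q.real (B v) * R := Finset.sum_le_sum fun v _ ↦ h1 v
      _ ≤ N * R := by rw [← Finset.sum_mul]; gcongr
  have : (0 : ℝ) < Fintype.card V := by exact_mod_cast Fintype.card_pos
  linarith

/-! ### Random sign vectors. -/

/-- The sign `±1` of a Boolean. -/
def boolSign (b : Bool) : ℝ := if b then 1 else -1

lemma boolSign_sq (b : Bool) : boolSign b ^ 2 = 1 := by cases b <;> simp [boolSign]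

/-- Chernoff bound with parameter `1/2`: the exponential moment is `cosh(1/2)^d ≤ exp(d/8)`, against
`exp(d/4)` at the threshold. -/
lemma ncard_half_le_sum_boolSign_mul {d : ℕ} {b : Fin d → ℝ} (hb : ∀ i, b i = 1 ∨ b i = -1) :
    ((Set.ncard {v : Fin d → Bool | (d : ℝ) / 2 ≤ ∑ i, boolSign (v i) * b i} : ℕ) : ℝ) ≤
      2 ^ d * Real.exp (-(d / 8)) := by
  classical
  have h1 : ∑ v : Fin d → Bool, Real.exp (∑ i, boolSign (v i) * b i / 2) ≤
      2 ^ d * Real.exp (d / 8) := by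
    simp_rw [Real.exp_sum]
    have := Finset.prod_univ_sum (fun _ : Fin d ↦ (Finset.univ : Finset Bool))
      (fun i c ↦ Real.exp (boolSign c * b i / 2))
    rw [Fintype.piFinset_univ] at this
    rw [← this]
    have h2 (i : Fin d) : ∑ c, Real.exp (boolSign c * b i / 2) = 2 * Real.cosh (1 / 2) := by
      rw [Real.cosh_eq]
      rcases hb i with h | h <;> simp [boolSign, h] <;> ring_nf
    simp_rw [h2, Finset.prod_const, Finset.card_univ, Fintype.card_fin, mul_pow]
    gcongr
    calc Real.cosh (1 / 2) ^ d ≤ Real.exp ((1 / 2) ^ 2 / 2) ^ d :=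
          pow_le_pow_left₀ (Real.cosh_pos _).le (Real.cosh_le_exp_half_sq _) d
      _ = Real.exp (d / 8) := by rw [← Real.exp_nat_mul]; ring_nf
  set F := Finset.univ.filter fun v : Fin d → Bool ↦ (d : ℝ) / 2 ≤ ∑ i, boolSign (v i) * b i
    with hF
  have hcard : Set.ncard {v : Fin d → Bool | (d : ℝ) / 2 ≤ ∑ i, boolSign (v i) * b i} =
      F.card := by
    rw [← Set.ncard_coe_finset, hF]; simp
  rw [hcard]
  have h2 : F.card * Real.exp (d / 4) ≤
      ∑ v : Fin d → Bool, Real.exp (∑ i, boolSign (v i) * b i / 2) := by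
    calc F.card * Real.exp (d / 4) = ∑ _v ∈ F, Real.exp (d / 4) := by simp
      _ ≤ ∑ v ∈ F, Real.exp (∑ i, boolSign (v i) * b i / 2) := by
        refine Finset.sum_le_sum fun v hv ↦ Real.exp_le_exp.2 ?_
        rw [← Finset.sum_div]
        have := (Finset.mem_filter.1 hv).2
        linarith
      _ ≤ _ := Finset.sum_le_sum_of_subset_of_nonneg (Finset.subset_univ _)
        fun _ _ _ ↦ (Real.exp_pos _).le
  have h3 : Real.exp (d / 8) = Real.exp (-(d / 8)) * Real.exp (d / 4) := by
    rw [← Real.exp_add]; ring_nf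
  rw [h3, ← mul_assoc] at h1
  exact le_of_mul_le_mul_right (h2.trans h1) (Real.exp_pos _)

lemma ncard_half_le_abs_sum_boolSign {d : ℕ} (a : Fin d → Bool) :
    ((Set.ncard {v : Fin d → Bool | (d : ℝ) / 2 ≤ |∑ i, boolSign (v i) * boolSign (a i)|} : ℕ) : ℝ)
      ≤ 2 * 2 ^ d * Real.exp (-(d / 8)) := by
  have h1 := ncard_half_le_sum_boolSign_mul (b := fun i ↦ boolSign (a i))
    fun i ↦ by cases a i <;> simp [boolSign]
  have h2 := ncard_half_le_sum_boolSign_mul (b := fun i ↦ -boolSign (a i))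
    fun i ↦ by cases a i <;> simp [boolSign]
  have h3 : {v : Fin d → Bool | (d : ℝ) / 2 ≤ |∑ i, boolSign (v i) * boolSign (a i)|} ⊆
      {v : Fin d → Bool | (d : ℝ) / 2 ≤ ∑ i, boolSign (v i) * boolSign (a i)} ∪
      {v : Fin d → Bool | (d : ℝ) / 2 ≤ ∑ i, boolSign (v i) * -boolSign (a i)} := by
    intro v hv
    simpa [le_abs, Finset.sum_neg_distrib] using hv
  have h4 := (Set.ncard_le_ncard h3 (Set.toFinite _)).trans (Set.ncard_union_le _ _)
  have h5 : ((Set.ncard {v : Fin d → Bool |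
      (d : ℝ) / 2 ≤ |∑ i, boolSign (v i) * boolSign (a i)|} : ℕ) : ℝ) ≤ _ := Nat.cast_le.2 h4
  push_cast at h5
  linarith

/-- The unit vector with coordinates `±1 / √d`. -/
noncomputable def signVector {d : ℕ} (v : Fin d → Bool) : EuclideanSpace ℝ (Fin d) :=
  WithLp.toLp 2 fun i ↦ boolSign (v i) / √d

lemma inner_signVector {d : ℕ} (v a : Fin d → Bool) :
    inner ℝ (signVector v) (signVector a) = (∑ i, boolSign (v i) * boolSign (a i)) / d := by
  rw [PiLp.inner_apply, Finset.sum_div]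
  refine Finset.sum_congr rfl fun i _ ↦ ?_
  simp only [signVector, RCLike.inner_apply, conj_trivial]
  rw [div_mul_div_comm, Real.mul_self_sqrt d.cast_nonneg, mul_comm]

lemma norm_signVector {d : ℕ} (hd : 0 < d) (v : Fin d → Bool) : ‖signVector v‖ = 1 := by
  have h : ‖signVector v‖ ^ 2 = 1 := by
    rw [← real_inner_self_eq_norm_sq, inner_signVector]
    simp_rw [← sq, boolSign_sq]
    simp [hd.ne']
  exact (pow_eq_one_iff_of_nonneg (norm_nonneg _) two_ne_zero).1 h

lemma one_le_norm_smul_sub_smul {E : Type*} [NormedAddCommGroup E] [InnerProductSpace ℝ E]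
    {u v : E} (hu : ‖u‖ = 1) (hv : ‖v‖ = 1) (h : |inner ℝ u v| ≤ 1 / 2) {r s : ℝ}
    (hr : r = 1 ∨ r = -1) (hs : s = 1 ∨ s = -1) : 1 ≤ ‖r • u - s • v‖ := by
  have h1 : ‖r • u - s • v‖ ^ 2 = 2 - 2 * (r * s * inner ℝ u v) := by
    rw [@norm_sub_sq_real, norm_smul, norm_smul, hu, hv, inner_smul_left, inner_smul_right]
    rcases hr with rfl | rfl <;> rcases hs with rfl | rfl <;> norm_num <;> ring
  have h2 := abs_le.1 h
  have h3 : 1 ≤ ‖r • u - s • v‖ ^ 2 := by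
    rw [h1]
    rcases hr with rfl | rfl <;> rcases hs with rfl | rfl <;> linarith
  exact (one_le_sq_iff₀ (norm_nonneg _)).1 h3

/-! ### One-dimensional distributions with matching moments. -/

/-- The equal mixture of `1` and `-1`, as a `k`-atomic distribution. -/
lemma exists_symmetric_nodes {k : ℕ} (hk : 2 ≤ k) : ∃ (w w' : Fin k → ℝ≥0) (y : Fin k → ℝ),
    ∑ i, w i = 1 ∧ ∑ i, w' i = 1 ∧ (∀ i, y i = 1 ∨ y i = -1) ∧ ∑ i, (w i : ℝ) * y i = 0 := by
  obtain ⟨k, rfl⟩ := Nat.exists_eq_add_of_le' hk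
  -- Surplus atoms get weight zero but still sit at `-1`, so the gap from `0` holds for every index.
  -- The weights `w'` later describe a point mass at `0`.
  refine ⟨Fin.cons (1 / 2) (Fin.cons (1 / 2) 0), Fin.cons 1 0, Fin.cons 1 fun _ ↦ -1,
    ?_, ?_, ?_, ?_⟩
  · simp only [Fin.sum_univ_succ, Fin.cons_zero, Fin.cons_succ, Pi.zero_apply,
      Finset.sum_const_zero, add_zero, add_halves]
  · simp [Fin.sum_univ_succ]
  · intro i
    refine Fin.cases ?_ (fun i ↦ ?_) i <;> simp
  · simp [Fin.sum_univ_succ]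

lemma sum_range_two_mul {M : Type*} [AddCommMonoid M] (f : ℕ → M) (k : ℕ) :
    ∑ j ∈ Finset.range (2 * k), f j = ∑ i : Fin k, f (2 * i) + ∑ i : Fin k, f (2 * i + 1) := by
  rw [Fin.sum_univ_eq_sum_range (fun i ↦ f (2 * i)), Fin.sum_univ_eq_sum_range
    (fun i ↦ f (2 * i + 1)), ← Finset.sum_add_distrib]
  induction k with
  | zero => simp
  | succ k ih => rw [mul_add, mul_one, Finset.sum_range_succ, Finset.sum_range_succ, ih,
      Finset.sum_range_succ, add_assoc]

/-- The sum is an `m`-th forward difference of a polynomial of degree below `m`. -/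
lemma sum_alternating_choose_mul_pow_eq_zero {m l : ℕ} (hl : l < m) (a b : ℝ) :
    ∑ j ∈ Finset.range (m + 1), (-1 : ℝ) ^ (m - j) * m.choose j * ((j - a) / b) ^ l = 0 := by
  have hd : ((Polynomial.C b⁻¹ * (Polynomial.X - Polynomial.C a)) ^ l).natDegree < m := by
    refine lt_of_le_of_lt Polynomial.natDegree_pow_le ?_
    have h1 : (Polynomial.C b⁻¹ * (Polynomial.X - Polynomial.C a)).natDegree ≤ 1 :=
      (Polynomial.natDegree_C_mul_le _ _).trans (by simp)
    exact (Nat.mul_le_mul_left l h1).trans_lt (by rwa [mul_one])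
  have h := congrFun (Polynomial.fwdDiff_iter_eq_zero_of_degree_lt hd) 0
  rw [fwdDiff_iter_eq_sum_shift, Pi.zero_apply] at h
  rw [← h]
  refine Finset.sum_congr rfl fun j _ ↦ ?_
  simp [div_eq_inv_mul]

/-- The even and the odd half of a binomial distribution agree in many moments. -/
lemma exists_binomial_nodes {k : ℕ} (hk : 1 ≤ k) :
    ∃ (w w' : Fin k → ℝ≥0) (y y' : Fin k → ℝ),
      ∑ i, w i = 1 ∧ ∑ i, w' i = 1 ∧ (∀ i, |y i| ≤ 1) ∧ (∀ i, |y' i| ≤ 1) ∧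
      ∑ i, (w' i : ℝ) * y' i = 0 ∧
      (∀ l < 2 * k - 1, ∑ i, (w i : ℝ) * y i ^ l = ∑ i, (w' i : ℝ) * y' i ^ l) ∧
      ∀ i j, 1 / (2 * k - 1 : ℝ) ≤ |y i - y' j| := by
  obtain ⟨m, hm⟩ : ∃ m, m = 2 * k - 1 := ⟨_, rfl⟩
  have hmk : m + 1 = 2 * k := by omega
  have hm0 : 0 < m := by omega
  have hmR : (0 : ℝ) < m := by exact_mod_cast hm0
  have hmcast : (2 * k - 1 : ℝ) = m := by
    have : (m : ℝ) + 1 = 2 * k := by exact_mod_cast hmk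
    linarith
  have halt (a : ℝ) (l : ℕ) (hl : l < m) :
      ∑ i : Fin k, (m.choose (2 * i) : ℝ) * (((2 * i : ℕ) - a) / m) ^ l =
        ∑ i : Fin k, (m.choose (2 * i + 1) : ℝ) * (((2 * i + 1 : ℕ) - a) / m) ^ l := by
    have h := sum_alternating_choose_mul_pow_eq_zero hl a m
    rw [hmk, sum_range_two_mul] at h
    -- As `m = 2k - 1` is odd, even indices carry the sign `-1` and odd ones `+1`.
    have e1 (i : Fin k) : (-1 : ℝ) ^ (m - 2 * i) = -1 :=
      Odd.neg_one_pow ⟨k - 1 - i, by have := i.2; omega⟩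
    have e2 (i : Fin k) : (-1 : ℝ) ^ (m - (2 * i + 1)) = 1 :=
      Even.neg_one_pow ⟨k - 1 - i, by have := i.2; omega⟩
    simp only [e1, e2, neg_mul, one_mul, Finset.sum_neg_distrib] at h
    linarith
  have htot : ∑ i : Fin k, (m.choose (2 * i) : ℝ) + ∑ i : Fin k, (m.choose (2 * i + 1) : ℝ) =
      2 ^ m := by
    rw [← sum_range_two_mul (fun j ↦ (m.choose j : ℝ)), ← hmk]
    exact_mod_cast Nat.sum_range_choose m
  have h0 := halt 0 0 hm0
  simp only [pow_zero, mul_one] at h0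
  have hpow : (2 : ℝ) ^ m = 2 * 2 ^ (m - 1) := by rw [← pow_succ', Nat.sub_add_cancel hm0]
  have hpos : (0 : ℝ) < 2 ^ (m - 1) := by positivity
  set w : Fin k → ℝ≥0 := fun i ↦ m.choose (2 * i) / 2 ^ (m - 1) with hw
  set w' : Fin k → ℝ≥0 := fun i ↦ m.choose (2 * i + 1) / 2 ^ (m - 1) with hw'
  have cw (i : Fin k) : (w i : ℝ) = m.choose (2 * i) / 2 ^ (m - 1) := by simp [hw]
  have cw' (i : Fin k) : (w' i : ℝ) = m.choose (2 * i + 1) / 2 ^ (m - 1) := by simp [hw']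
  have sw : ∑ i, (w i : ℝ) = 1 := by
    simp_rw [cw]; rw [← Finset.sum_div, div_eq_one_iff_eq hpos.ne']; linarith
  have sw' : ∑ i, (w' i : ℝ) = 1 := by
    simp_rw [cw']; rw [← Finset.sum_div, div_eq_one_iff_eq hpos.ne']; linarith
  -- Centring at the mean of the odd half gives the mean-zero condition; dividing by `m` puts all
  -- nodes in `[-1, 1]`.
  set a : ℝ := ∑ i, (w' i : ℝ) * (2 * i + 1 : ℕ) with ha
  have ha0 : 0 ≤ a := Finset.sum_nonneg fun i _ ↦ by positivity
  have ham : a ≤ m := by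
    calc a ≤ ∑ i, (w' i : ℝ) * m := by
          refine Finset.sum_le_sum fun i _ ↦ ?_
          gcongr
          have := i.2; omega
      _ = m := by rw [← Finset.sum_mul, sw', one_mul]
  have hbound (j : ℕ) (hj : j ≤ m) : |((j : ℝ) - a) / m| ≤ 1 := by
    have hj' : (j : ℝ) ≤ m := by exact_mod_cast hj
    rw [abs_div, abs_of_pos hmR, div_le_one hmR, abs_le]
    constructor <;> linarith [(Nat.cast_nonneg j : (0 : ℝ) ≤ j)]
  refine ⟨w, w', fun i ↦ ((2 * i : ℕ) - a) / m, fun i ↦ ((2 * i + 1 : ℕ) - a) / m,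
    by exact_mod_cast sw, by exact_mod_cast sw', fun i ↦ hbound _ (by have := i.2; omega),
    fun i ↦ hbound _ (by have := i.2; omega), ?_, ?_, ?_⟩
  · simp_rw [← mul_div_assoc, mul_sub]
    rw [← Finset.sum_div, Finset.sum_sub_distrib, ← ha, ← Finset.sum_mul, sw', one_mul, sub_self,
      zero_div]
  · intro l hl
    rw [← hm] at hl
    simp_rw [cw, cw', div_mul_eq_mul_div]
    rw [← Finset.sum_div, ← Finset.sum_div, halt a l hl]
  · intro i j
    rw [hmcast, ← sub_div, abs_div, abs_of_pos hmR]
    gcongr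
    have : (1 : ℤ) ≤ |((2 * i : ℕ) : ℤ) - ((2 * j + 1 : ℕ) : ℤ)| := by
      exact Int.one_le_abs (by omega)
    have h2 : (1 : ℝ) ≤ |((2 * i : ℕ) : ℝ) - ((2 * j + 1 : ℕ) : ℝ)| := by exact_mod_cast this
    rwa [sub_sub_sub_cancel_right]

/-! ### Lower bounds for estimation. -/

section lowerBound

variable {n d k m : ℕ} {δ : ℝ} {σ : Fin n → ℝ}

lemma smul_mem_closedBall {e : EuclideanSpace ℝ (Fin d)} (he : ‖e‖ = 1) {η y : ℝ}
    (hη0 : 0 ≤ η) (hη1 : η ≤ 1) (hy : |y| ≤ 1) : (η * y) • e ∈ Metric.closedBall 0 1 := by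
  rw [mem_closedBall_zero_iff, norm_smul, he, mul_one, Real.norm_eq_abs, abs_mul,
    abs_of_nonneg hη0]
  exact mul_le_one₀ hη1 (abs_nonneg _) hy

/-- Two distributions on a line with equal moments yield a lower bound for estimation. -/
lemma exists_le_sampleLaw_of_moments_eq (hσ : ∀ j, 1 ≤ σ j) (hδ0 : 0 < δ) (hδ : δ ≤ 1 / 4)
    {e : EuclideanSpace ℝ (Fin d)} (he : ‖e‖ = 1) {η : ℝ} (hη0 : 0 ≤ η) (hη1 : η ≤ 1)
    {w w' : Fin k → ℝ≥0} {y y' : Fin k → ℝ} (hw : ∑ i, w i = 1)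
    (hw' : ∑ i, w' i = 1) (hy : ∀ i, |y i| ≤ 1) (hy' : ∀ i, |y' i| ≤ 1)
    (hmean : ∑ i, (w' i : ℝ) * y' i = 0)
    (hmom : ∀ l < m, ∑ i, (w i : ℝ) * y i ^ l = ∑ i, (w' i : ℝ) * y' i ^ l)
    (hm : 20 * η ^ (2 * m) * ∑ j, 1 / σ j ^ (2 * m) ≤ Real.log (1 / δ) / 2)
    {g s : ℝ} (hs : 0 ≤ s) (hgap : ∀ i j, g ≤ |y i - y' j|) (hsg : 2 * s ≤ η * g)
    (T : (Fin n → EuclideanSpace ℝ (Fin d)) → ProbabilityMeasure (EuclideanSpace ℝ (Fin d))) :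
    ∃ D : ProbabilityMeasure (EuclideanSpace ℝ (Fin d)),
      IsKAtomic k (D : Measure (EuclideanSpace ℝ (Fin d))) ∧
      (∀ᵐ x ∂(D : Measure (EuclideanSpace ℝ (Fin d))), x ∈ Metric.closedBall 0 1) ∧
      ENNReal.ofReal δ ≤ sampleLaw σ (D : Measure (EuclideanSpace ℝ (Fin d)))
        {X | ENNReal.ofReal s ≤ wasserstein (T X : Measure (EuclideanSpace ℝ (Fin d))) D} := by
  set D : Measure (EuclideanSpace ℝ (Fin d)) :=
    ∑ i, w i • Measure.dirac ((η * y i) • e) with hD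
  set D' : Measure (EuclideanSpace ℝ (Fin d)) :=
    ∑ i, w' i • Measure.dirac ((η * y' i) • e) with hD'
  have : IsProbabilityMeasure D := isProbabilityMeasure_sum_dirac hw
  have : IsProbabilityMeasure D' := isProbabilityMeasure_sum_dirac hw'
  -- The left side is `√δ`, and `δ ≤ 1/4`.
  have hR : δ * Real.exp (Real.log (1 / δ) / 2) ≤ 1 / 2 := by
    have h1 : Real.exp (Real.log (1 / δ) / 2) ^ 2 = 1 / δ := by
      rw [← Real.exp_nat_mul, Nat.cast_ofNat, mul_div_cancel₀ _ two_ne_zero,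
        Real.exp_log (by positivity)]
    have h2 : (δ * Real.exp (Real.log (1 / δ) / 2)) ^ 2 ≤ (1 / 2) ^ 2 := by
      rw [mul_pow, h1, sq, mul_assoc, mul_one_div_cancel hδ0.ne']
      linarith
    exact abs_le_of_sq_le_sq' h2 (by norm_num) |>.2
  have hsep (μ : Measure (EuclideanSpace ℝ (Fin d))) [IsProbabilityMeasure μ] :
      ENNReal.ofReal (2 * s) ≤ wasserstein μ D + wasserstein μ D' := by
    refine le_wasserstein_add_wasserstein (S := Set.range fun i ↦ (η * y i) • e)
      (S' := Set.range fun i ↦ (η * y' i) • e)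
      (ae_mem_sum_dirac (Set.finite_range _).measurableSet fun i ↦ ⟨i, rfl⟩)
      (ae_mem_sum_dirac (Set.finite_range _).measurableSet fun i ↦ ⟨i, rfl⟩) ?_
    rintro _ ⟨i, rfl⟩ _ ⟨j, rfl⟩
    rw [edist_dist, dist_eq_norm, ← sub_smul, norm_smul, he, mul_one, ← mul_sub,
      Real.norm_eq_abs, abs_mul, abs_of_nonneg hη0]
    exact ENNReal.ofReal_le_ofReal
      (hsg.trans (mul_le_mul_of_nonneg_left (hgap i j) hη0))
  have hcov : {X | ENNReal.ofReal s ≤ wasserstein (T X : Measure (EuclideanSpace ℝ (Fin d))) D} ∪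
      {X | ENNReal.ofReal s ≤ wasserstein (T X : Measure (EuclideanSpace ℝ (Fin d))) D'} =
      Set.univ := by
    refine Set.eq_univ_of_forall fun X ↦ ?_
    by_contra hX
    simp only [Set.mem_union, Set.mem_ofPred_eq, not_or, not_le] at hX
    have h1 := ENNReal.add_lt_add hX.1 hX.2
    rw [← ENNReal.ofReal_add hs hs, ← two_mul] at h1
    exact absurd (hsep (T X : Measure (EuclideanSpace ℝ (Fin d)))) (not_le.2 h1)
  rcases le_measure_or_le_measure_of_sq_le (P := sampleLaw σ D) (Q := sampleLaw σ D') hcov hδ0 hδ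
    (Real.exp_pos _).le hR
    (fun B hB ↦ sq_sampleLaw_le_of_moments_eq hσ he hη0 hη1 hw hw' hy hy' hmean hmom hm hB)
    with h | h
  · exact ⟨⟨D, inferInstance⟩, ⟨w, _, hw, hD⟩, ae_mem_sum_dirac
      Metric.isClosed_closedBall.measurableSet fun i ↦ smul_mem_closedBall he hη0 hη1 (hy i), h⟩
  · exact ⟨⟨D', inferInstance⟩, ⟨w', _, hw', hD'⟩, ae_mem_sum_dirac
      Metric.isClosed_closedBall.measurableSet fun i ↦ smul_mem_closedBall he hη0 hη1 (hy' i), h⟩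

/-- The lower bound in high dimension, from an average over all sign vectors. -/
lemma exists_le_sampleLaw_of_dimension_large (hσ : ∀ j, 1 ≤ σ j) (hk : 2 ≤ k) (hd : 40 ≤ d)
    {η : ℝ} (hη0 : 0 ≤ η) (hη1 : η ≤ 1) (hQ : 20 * η ^ 4 * ∑ j, 1 / σ j ^ 4 ≤ d / 32)
    {s : ℝ} (hs : 0 ≤ s) (hsη : 2 * s ≤ η)
    (T : (Fin n → EuclideanSpace ℝ (Fin d)) → ProbabilityMeasure (EuclideanSpace ℝ (Fin d))) :
    ∃ D : ProbabilityMeasure (EuclideanSpace ℝ (Fin d)),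
      IsKAtomic k (D : Measure (EuclideanSpace ℝ (Fin d))) ∧
      (∀ᵐ x ∂(D : Measure (EuclideanSpace ℝ (Fin d))), x ∈ Metric.closedBall 0 1) ∧
      ENNReal.ofReal (1 / 4) ≤ sampleLaw σ (D : Measure (EuclideanSpace ℝ (Fin d)))
        {X | ENNReal.ofReal s ≤ wasserstein (T X : Measure (EuclideanSpace ℝ (Fin d))) D} := by
  have hd0 : 0 < d := by omega
  have hdR : (0 : ℝ) < d := by exact_mod_cast hd0
  obtain ⟨w, w', y, hw, hw', hy, hmean⟩ := exists_symmetric_nodes hk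
  have hy1 (i : Fin k) : |y i| ≤ 1 := by rcases hy i with h | h <;> simp [h]
  let D (v : Fin d → Bool) : Measure (EuclideanSpace ℝ (Fin d)) :=
    ∑ i, w i • Measure.dirac ((η * y i) • signVector v)
  let D₀ : Measure (EuclideanSpace ℝ (Fin d)) := ∑ i, w' i • Measure.dirac 0
  have hDp (v : Fin d → Bool) : IsProbabilityMeasure (D v) := isProbabilityMeasure_sum_dirac hw
  have : IsProbabilityMeasure D₀ := isProbabilityMeasure_sum_dirac hw'
  have hsep (v a : Fin d → Bool) (hva : |∑ i, boolSign (v i) * boolSign (a i)| ≤ d / 2)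
      (μ : Measure (EuclideanSpace ℝ (Fin d))) [IsProbabilityMeasure μ] :
      ENNReal.ofReal (2 * s) ≤ wasserstein μ (D v) + wasserstein μ (D a) := by
    refine le_wasserstein_add_wasserstein (S := Set.range fun i ↦ (η * y i) • signVector v)
      (S' := Set.range fun i ↦ (η * y i) • signVector a)
      (ae_mem_sum_dirac (Set.finite_range _).measurableSet fun i ↦ ⟨i, rfl⟩)
      (ae_mem_sum_dirac (Set.finite_range _).measurableSet fun i ↦ ⟨i, rfl⟩) ?_
    rintro _ ⟨i, rfl⟩ _ ⟨j, rfl⟩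
    beta_reduce
    rw [edist_dist, dist_eq_norm, mul_smul, mul_smul, ← smul_sub, norm_smul, Real.norm_eq_abs,
      abs_of_nonneg hη0]
    have h1 := one_le_norm_smul_sub_smul (norm_signVector hd0 v) (norm_signVector hd0 a)
      (by
        rw [inner_signVector, abs_div, abs_of_pos hdR, div_le_iff₀ hdR]
        linarith) (hy i) (hy j)
    exact ENNReal.ofReal_le_ofReal (hsη.trans (le_mul_of_one_le_right hη0 h1))
  have hcard (X : Fin n → EuclideanSpace ℝ (Fin d)) :
      ((Set.ncard {v | X ∉ {X | ENNReal.ofReal s ≤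
        wasserstein (T X : Measure (EuclideanSpace ℝ (Fin d))) (D v)}} : ℕ) : ℝ) ≤
      2 * 2 ^ d * Real.exp (-(d / 8)) := by
    simp only [Set.mem_ofPred_eq, not_le]
    rcases Set.eq_empty_or_nonempty {v | wasserstein (T X : Measure (EuclideanSpace ℝ (Fin d)))
      (D v) < ENNReal.ofReal s} with h | ⟨a, ha⟩
    · rw [h]; simp; positivity
    -- Fix one `a` whose law is close to `T X`. By separation, every other such `v` is strongly
    -- correlated with `a`.
    · refine le_trans (Nat.cast_le.2 (Set.ncard_le_ncard (fun v hv ↦ ?_) (Set.toFinite _)))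
        (ncard_half_le_abs_sum_boolSign a)
      by_contra hva
      have h1 := ENNReal.add_lt_add hv ha
      rw [← ENNReal.ofReal_add hs hs, ← two_mul] at h1
      exact absurd (hsep v a (not_le.1 hva).le (T X : Measure (EuclideanSpace ℝ (Fin d))))
        (not_le.2 h1)
  -- The chi-square budget `d/32` is beaten by the packing exponent `d/8`; `d ≥ 40` absorbs the
  -- constants.
  have hNR : 2 * 2 ^ d * Real.exp (-(d / 8)) * Real.exp (d / 32) ≤
      (Fintype.card (Fin d → Bool) : ℝ) / 2 := by
    have h1 : Real.exp (-(d / 8 : ℝ)) * Real.exp (d / 32) ≤ 1 / 4 := by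
      rw [← Real.exp_add]
      have h2 : (-(d / 8) + d / 32 : ℝ) ≤ -3 := by
        have : (40 : ℝ) ≤ d := by exact_mod_cast hd
        linarith
      refine (Real.exp_le_exp.2 h2).trans ?_
      rw [Real.exp_neg, one_div]
      refine inv_anti₀ (by norm_num) ?_
      linarith [Real.add_one_le_exp (3 : ℝ)]
    rw [Fintype.card_fun, Fintype.card_bool, Fintype.card_fin]
    push_cast
    have := mul_le_mul_of_nonneg_left h1 (show (0 : ℝ) ≤ 2 * 2 ^ d by positivity)
    linarith
  obtain ⟨v, hv⟩ := exists_le_measure_of_card_le (P := fun v ↦ sampleLaw σ (D v))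
    (Q := sampleLaw σ D₀) (Real.exp_pos _).le hcard hNR (fun v B hB ↦ by
      have := sq_sampleLaw_le_of_moments_eq (m := 2) hσ (norm_signVector hd0 v) hη0 hη1 hw hw' hy1
        (y' := fun _ ↦ 0) (by simp) (by simp) (fun l hl ↦ by
          have h1 : ∑ i, (w i : ℝ) = 1 := by exact_mod_cast hw
          have h2 : ∑ i, (w' i : ℝ) = 1 := by exact_mod_cast hw'
          interval_cases l <;> simp [h1, h2, hmean]) hQ hB
      simpa [D, D₀] using this)
  exact ⟨⟨D v, inferInstance⟩, ⟨w, _, hw, rfl⟩, ae_mem_sum_dirac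
      Metric.isClosed_closedBall.measurableSet
      fun i ↦ smul_mem_closedBall (norm_signVector hd0 v) hη0 hη1 (hy1 i), hv⟩

end lowerBound

/-! ### Choice of scales and the main theorem. -/

theorem mainTheorem3 :
    ∃ C c : ℝ, 0 < C ∧ 0 < c ∧
      ∀ (n k d : ℕ) (δ : ℝ) (σ : Fin n → ℝ),
        2 ≤ k → 3 ≤ d → 0 < δ → δ ≤ 1 / 4 → (∀ i, 1 ≤ σ i) →
        (C * k) ^ (2 * k - 1) * Real.log (1 / δ) ≤ ∑ i, 1 / σ i ^ (4 * k - 2) →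
        C * (d + Real.log (1 / δ)) ≤ ∑ i, 1 / σ i ^ 4 →
        ∀ T : (Fin n → EuclideanSpace ℝ (Fin d)) → ProbabilityMeasure (EuclideanSpace ℝ (Fin d)),
          ∃ D : ProbabilityMeasure (EuclideanSpace ℝ (Fin d)),
            IsKAtomic k (D : Measure (EuclideanSpace ℝ (Fin d))) ∧
            (∀ᵐ x ∂(D : Measure (EuclideanSpace ℝ (Fin d))), x ∈ Metric.closedBall 0 1) ∧
            ENNReal.ofReal δ ≤
              sampleLaw σ (D : Measure (EuclideanSpace ℝ (Fin d)))
                {X | ENNReal.ofReal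
                    (c * max
                      (((d + Real.log (1 / δ)) / ∑ i, 1 / σ i ^ 4) ^ ((1 : ℝ) / 4))
                      (1 / k * (1 / Real.log (1 / δ) * ∑ i, 1 / σ i ^ (4 * k - 2)) ^
                        (-1 / (4 * k - 2) : ℝ)))
                  ≤ wasserstein (T X : Measure (EuclideanSpace ℝ (Fin d)))
                      (D : Measure (EuclideanSpace ℝ (Fin d)))} := by
  -- `C = 1` is enough to keep the scales `η` at most 1. Any `c ≤ 1/14` would meet the separation
  -- conditions of all three cases.
  refine ⟨1, 1 / 24, one_pos, by norm_num, ?_⟩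
  intro n k d δ σ hk hd hδ0 hδ hσ hS hQ T
  set L := Real.log (1 / δ) with hL
  set Q := ∑ i, 1 / σ i ^ 4 with hQdef
  set S := ∑ i, 1 / σ i ^ (4 * k - 2) with hSdef
  have hL1 : 1 ≤ L := by
    rw [hL, Real.le_log_iff_exp_le (by positivity), le_div_iff₀ hδ0]
    have := Real.exp_one_lt_d9
    nlinarith
  have hL0 : 0 < L := by linarith
  have hdR : (3 : ℝ) ≤ d := by exact_mod_cast hd
  have hkR : (2 : ℝ) ≤ k := by exact_mod_cast hk
  have hQ0 : 0 < Q := by linarith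
  have hroot {x : ℝ} (hx : 0 ≤ x) : (x ^ ((1 : ℝ) / 4)) ^ 4 = x := by
    rw [← Real.rpow_natCast, ← Real.rpow_mul hx]; norm_num
  set e : EuclideanSpace ℝ (Fin d) := signVector fun _ ↦ true
  have he : ‖e‖ = 1 := norm_signVector (by omega) _
  set a := ((d + L) / Q) ^ ((1 : ℝ) / 4) with ha
  have ha0 : 0 ≤ a := by positivity
  have ha4 : a ^ 4 = (d + L) / Q := hroot (by positivity)
  set b := 1 / k * (1 / L * S) ^ (-1 / (4 * k - 2) : ℝ) with hb
  rcases le_total a b with hab | hab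
  · rw [max_eq_right hab]
    have hSL : 1 ≤ 1 / L * S := by
      rw [one_div_mul_eq_div, le_div_iff₀ hL0]
      refine le_trans (mul_le_mul_of_nonneg_right (one_le_pow₀ ?_) hL0.le) hS
      linarith
    have hS0 : 0 < S := by
      by_contra h
      have := mul_nonpos_of_nonneg_of_nonpos (one_div_pos.2 hL0).le (not_lt.1 h)
      linarith
    set ρ := (1 / L * S) ^ (-1 / (4 * k - 2) : ℝ) with hρ
    have hρ0 : 0 ≤ ρ := by positivity
    have hρ1 : ρ ≤ 1 := Real.rpow_le_one_of_one_le_of_nonpos hSL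
      (div_nonpos_of_nonpos_of_nonneg (by norm_num) (by linarith))
    have hρpow : ρ ^ (2 * (2 * k - 1)) = L / S := by
      have hcast : ((2 * (2 * k - 1) : ℕ) : ℝ) = 4 * k - 2 := by
        rw [Nat.cast_mul, Nat.cast_sub (by omega)]; push_cast; ring
      rw [hρ, ← Real.rpow_natCast, ← Real.rpow_mul (by positivity), hcast,
        div_mul_cancel₀ _ (by linarith : (0 : ℝ) < 4 * k - 2).ne', Real.rpow_neg_one]
      field_simp
    obtain ⟨w, w', y, y', hw, hw', hy, hy', hmean, hmom, hgap⟩ :=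
      exists_binomial_nodes (k := k) (by omega)
    refine exists_le_sampleLaw_of_moments_eq (m := 2 * k - 1) hσ hδ0 hδ he (η := ρ / 2)
      (by positivity) (by linarith) hw hw' hy hy' hmean hmom ?_ (by positivity) hgap ?_ T
    · have hexp : 4 * k - 2 = 2 * (2 * k - 1) := by omega
      rw [div_pow, hρpow, ← hexp, ← hSdef, hexp]
      -- Halving `ρ` gains this factor, which brings `20 L` below `L / 2`.
      have h64 : (64 : ℝ) ≤ 2 ^ (2 * (2 * k - 1)) := by
        calc (64 : ℝ) = 2 ^ 6 := by norm_num
          _ ≤ _ := pow_le_pow_right₀ (by norm_num) (by omega)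
      have : 20 * (L / S / 2 ^ (2 * (2 * k - 1))) * S = 20 * L / 2 ^ (2 * (2 * k - 1)) := by
        field_simp
      rw [this, div_le_iff₀ (by positivity)]
      nlinarith
    · rw [hb]
      have h1 : 1 / (2 * k : ℝ) ≤ 1 / (2 * k - 1) :=
        one_div_le_one_div_of_le (by linarith) (by linarith)
      have h2 := mul_le_mul_of_nonneg_left h1 (div_nonneg hρ0 zero_le_two)
      have h3 : ρ / 2 * (1 / (2 * k)) = ρ * (1 / k) / 4 := by field_simp; norm_num
      have h4 : 0 ≤ ρ * (1 / k) := by positivity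
      linarith
  · rw [max_eq_left hab]
    rcases le_or_gt (d : ℝ) (32 * L) with hdL | hdL
    -- Chosen so that `20 η⁴ Q = L / 2`. Here `d + L ≤ 33 L`, so `a` is comparable to `η`.
    · set η := (L / (40 * Q)) ^ ((1 : ℝ) / 4) with hη
      have hη0 : 0 ≤ η := by positivity
      have hη4 : η ^ 4 = L / (40 * Q) := hroot (by positivity)
      have hη1 : η ≤ 1 := by
        refine Real.rpow_le_one (by positivity) ?_ (by norm_num)
        rw [div_le_one (by positivity)]; linarith
      have haη : a ≤ 7 * η := by
        refine le_of_pow_le_pow_left₀ four_ne_zero (by positivity) ?_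
        rw [mul_pow, ha4, hη4, div_le_iff₀ hQ0]
        have : 7 ^ 4 * (L / (40 * Q)) * Q = 7 ^ 4 / 40 * L := by field_simp
        rw [this]; linarith
      obtain ⟨w, w', y, hw, hw', hy, hmean⟩ := exists_symmetric_nodes hk
      have hy1 (i : Fin k) : |y i| = 1 := by rcases hy i with h | h <;> simp [h]
      refine exists_le_sampleLaw_of_moments_eq (m := 2) hσ hδ0 hδ he hη0 hη1 hw hw'
        (fun i ↦ (hy1 i).le) (y' := fun _ ↦ 0) (by simp) (by simp) (fun l hl ↦ ?_) ?_
        (by positivity) (g := 1) (fun i j ↦ by simp [hy1]) (by linarith) T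
      · have h1 : ∑ i, (w i : ℝ) = 1 := by exact_mod_cast hw
        have h2 : ∑ i, (w' i : ℝ) = 1 := by exact_mod_cast hw'
        interval_cases l <;> simp [h1, h2, hmean]
      · rw [show 2 * 2 = 4 from rfl, hη4, ← hQdef, ← hL]
        apply le_of_eq
        field_simp
        norm_num
    -- Chosen so that `20 η⁴ Q = d / 32`.
    · set η := (d / (640 * Q)) ^ ((1 : ℝ) / 4) with hη
      have hη0 : 0 ≤ η := by positivity
      have hη4 : η ^ 4 = d / (640 * Q) := hroot (by positivity)
      have hη1 : η ≤ 1 := by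
        refine Real.rpow_le_one (by positivity) ?_ (by norm_num)
        rw [div_le_one (by positivity)]; linarith
      have haη : a ≤ 7 * η := by
        refine le_of_pow_le_pow_left₀ four_ne_zero (by positivity) ?_
        rw [mul_pow, ha4, hη4, div_le_iff₀ hQ0]
        have : 7 ^ 4 * (d / (640 * Q)) * Q = 7 ^ 4 / 640 * d := by field_simp
        rw [this]; linarith
      -- Together with `32 L < d` this forces `d ≥ 40`.
      have hlog4 : 1.25 ≤ L := by
        have h2 := Real.log_two_gt_d9
        have h4 : Real.log 4 = 2 * Real.log 2 := by
          rw [show (4 : ℝ) = 2 ^ 2 by norm_num, Real.log_pow]; norm_num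
        have h5 : Real.log 4 ≤ L :=
          Real.log_le_log (by norm_num) (by rw [le_div_iff₀ hδ0]; linarith)
        linarith
      have hd40 : 40 ≤ d := by
        have : (40 : ℝ) ≤ d := by linarith
        exact_mod_cast this
      obtain ⟨D, h1, h2, h3⟩ := exists_le_sampleLaw_of_dimension_large hσ hk hd40 hη0 hη1
        (by
          rw [hη4, ← hQdef]
          apply le_of_eq
          field_simp
          norm_num) (s := 1 / 24 * a) (by positivity) (by linarith) T
      exact ⟨D, h1, h2, (ENNReal.ofReal_le_ofReal hδ).trans h3⟩
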